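/- A hyperelliptic surface is a complex surface $S$ with a Bagnera--de Franchis realization $S=(E\times F)/G$: here $E$ and $F$ are elliptic curves, $G$ is a finite group of translations of $E$ which acts faithfully on $F$ by holomorphic automorphisms with $F/G\cong\mathbb{P}^1$, and the quotient is by the diagonal action. A real hyperelliptic surface $(S,\sigma)$ is a hyperelliptic surface $S$ with an antiholomorphic involution $\sigma$. Its extended symmetry group $\hat G$ (relative to a realization) is the group of homeomorphisms of $E\times F$ generated by $G$ and the lifts of $\sigma$ to $E\times F$. Theorem. Let $(S,\sigma)$ and $(\hat S,\hat\sigma)$ be isomorphic real hyperelliptic surfaces, with Bagnera--de Franchis realizations $\pi\colon E\times F\to S=(E\times F)/G$ and $\hat\pi\colon \hat E\times\hat F\to\hat S=(\hat E\times\hat F)/G'$, and let $\psi\colon S\to\hat S$ be any biholomorphic map with $\psi^{-1}\hat\sigma\psi=\sigma$. Then $\sigma$ lifts to a homeomorphism of $E\times F$ and $\hat\sigma$ to one of $\hat E\times\hat F$, and the respective extended symmetry groups $\hat G$ and $\hat G'$ are the same, in the following sense: there are a group isomorphism $\varphi\colon\hat G\to\hat G'$, which maps $G$ onto $G'$ and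 the lifts of $\sigma$ onto the lifts of $\hat\sigma$, and biholomorphic maps $\Psi_1\colon E\to\hat E$ and $\Psi_2\colon F\to\hat F$ such that the product-type isomorphism $\Psi=\Psi_1\times\Psi_2\colon E\times F\to\hat E\times\hat F$ induces $\psi$, i.e. $\hat\pi\circ\Psi=\psi\circ\pi$, and commutes with the actions of the extended symmetry groups identified by $\varphi$, i.e. $\Psi\circ h=\varphi(h)\circ\Psi$ for all $h\in\hat G$. (The isomorphism $\varphi$ may depend on $\psi$.) -/

import Mathlib

open scoped Manifold ContDiff Topology

/-- `E` (with its complex structure and group law) is an elliptic curve: it is the quotient `ℂ / Λ`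
of `ℂ` by a lattice `Λ`.  The quotient map `p : ℂ → E` is a locally biholomorphic homomorphism,
which is surjective with kernel `Λ`. -/
def IsEllipticCurve (E : Type*) [TopologicalSpace E] [ChartedSpace ℂ E] [AddCommGroup E] : Prop :=
  ∃ (Λ : Submodule ℤ ℂ) (_ : DiscreteTopology Λ) (_ : IsZLattice ℝ Λ) (p : ℂ →+ E),
    IsLocalDiffeomorph 𝓘(ℂ) 𝓘(ℂ) ω p ∧ Function.Surjective p ∧ ∀ z : ℂ, p z = 0 ↔ z ∈ Λ

/-- A map from a Riemann surface to the complex projective line is holomorphic if it is locally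
given by a pair of holomorphic homogeneous coordinates without common zeros. -/
def IsHolomorphicToP1 {F : Type*} [TopologicalSpace F] [ChartedSpace ℂ F]
    (q : F → Projectivization ℂ (Fin 2 → ℂ)) : Prop :=
  ∀ x : F, ∃ s : F → Fin 2 → ℂ, ContMDiffAt 𝓘(ℂ) 𝓘(ℂ, Fin 2 → ℂ) ω s x ∧
    ∀ᶠ y in 𝓝 x, ∃ hs : s y ≠ 0, q y = Projectivization.mk ℂ (s y) hs

/-- A Bagnera - de Franchis realization `S = (E × F) / G` of the complex surface `S`, for elliptic
curves `E` and `F`. -/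
structure BagneraDeFranchis (E F S : Type*)
    [TopologicalSpace E] [ChartedSpace ℂ E] [AddCommGroup E]
    [TopologicalSpace F] [ChartedSpace ℂ F]
    [TopologicalSpace S] [ChartedSpace (ℂ × ℂ) S] where
  /-- the group `G`, a finite group of translations of `E` -/
  G : AddSubgroup E
  finite_G : Finite G
  /-- the action of `G` on `F` -/
  ρ : Multiplicative G →* (F ≃ₜ F)
  /-- `G` acts on `F` by holomorphic automorphisms -/
  holomorphic_ρ : ∀ g, ContMDiff 𝓘(ℂ) 𝓘(ℂ) ω (ρ g)
  /-- the action of `G` on `F` is faithful -/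
  faithful_ρ : Function.Injective ρ
  /-- `F / G` is the projective line: there is a surjective holomorphic map from `F` to the
  projective line whose fibres are the orbits of `G` -/
  quotient_F : ∃ q : F → Projectivization ℂ (Fin 2 → ℂ),
    IsHolomorphicToP1 q ∧ Function.Surjective q ∧ ∀ x y : F, q x = q y ↔ ∃ g, y = ρ g x
  /-- the quotient map of `E × F` by the diagonal action of `G` -/
  π : E × F → S
  /-- the complex structure of `S` is the quotient structure -/
  localBiholomorphic_π :
    IsLocalDiffeomorph (𝓘(ℂ).prod 𝓘(ℂ)) 𝓘(ℂ, ℂ × ℂ) ω π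
  surjective_π : Function.Surjective π
  /-- the fibres of the quotient map are the orbits of `G` -/
  π_eq_iff : ∀ x y : E × F, π x = π y ↔
    ∃ g : G, y = ((g : E) + x.1, ρ (Multiplicative.ofAdd g) x.2)

namespace BagneraDeFranchis

variable {E F S : Type*}
  [TopologicalSpace E] [ChartedSpace ℂ E] [AddCommGroup E] [LieAddGroup 𝓘(ℂ) ω E]
  [TopologicalSpace F] [ChartedSpace ℂ F]
  [TopologicalSpace S] [ChartedSpace (ℂ × ℂ) S]

/-- The diagonal action of `G` on `E × F`, `g (e, f) = (e + g, g f)`. -/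
def action (R : BagneraDeFranchis E F S) : Multiplicative R.G →* (E × F ≃ₜ E × F) where
  toFun g :=
    haveI : IsTopologicalAddGroup E := topologicalAddGroup_of_lieAddGroup 𝓘(ℂ) ω
    (Homeomorph.addLeft ((Multiplicative.toAdd g : R.G) : E)).prodCongr (R.ρ g)
  map_one' := by
    ext x <;> simp
  map_mul' g h := by
    ext x <;> simp [add_assoc]

/-- The group `G`, as a group of homeomorphisms of `E × F`. -/
def symmetryGroup (R : BagneraDeFranchis E F S) : Subgroup (E × F ≃ₜ E × F) :=
  R.action.range

/-- `h` is a lift to `E × F` of the map `σ : S → S`. -/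
def IsLift (R : BagneraDeFranchis E F S) (σ : S → S) (h : E × F ≃ₜ E × F) : Prop :=
  ∀ x, R.π (h x) = σ (R.π x)

/-- The extended symmetry group, generated by `G` and the lifts of `σ` to `E × F`.  (Two lifts
differ by an element of `G`, so this is the group generated by `G` and any one lift.) -/
def extendedSymmetryGroup (R : BagneraDeFranchis E F S) (σ : S → S) :
    Subgroup (E × F ≃ₜ E × F) :=
  Subgroup.closure ((R.symmetryGroup : Set (E × F ≃ₜ E × F)) ∪ {h | R.IsLift σ h})

end BagneraDeFranchis

/-- A self-map of a complex surface is antiholomorphic if it is continuous and, read in holomorphic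
charts and followed by complex conjugation, it is complex differentiable at every point. -/
def IsAntiholomorphic {S : Type*} [TopologicalSpace S] [ChartedSpace (ℂ × ℂ) S]
    (σ : S → S) : Prop :=
  Continuous σ ∧ ∀ x : S, DifferentiableAt ℂ
    (fun z : ℂ × ℂ => star (chartAt (ℂ × ℂ) (σ x) (σ ((chartAt (ℂ × ℂ) x).symm z))))
    (chartAt (ℂ × ℂ) x x)

/-- `σ` is an antiholomorphic involution of `S`, that is, `(S, σ)` is a real surface. -/
structure IsRealStructure {S : Type*} [TopologicalSpace S] [ChartedSpace (ℂ × ℂ) S]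
    (σ : S → S) : Prop where
  antiholomorphic : IsAntiholomorphic σ
  involutive : Function.Involutive σ

/-!
# Isomorphisms of real hyperelliptic surfaces are of product type

Let `S = (E × F) / G` and let `p : ℂ → E` and `r : ℂ → F` be the quotient maps by the period
lattices.  The universal covering of `S` is `ℂ × ℂ → E × F → S`.  A holomorphic automorphism of `F`
of finite order lifts to an affine map of `ℂ`, so the deck transformations are maps
`(z, w) ↦ (z + a, ζ w + b)` with `|ζ| = 1` (`IsUniformization.exists_affine_lift`,
`BagneraDeFranchis.exists_isDeck_of_lifts`); in particular they are isometries.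

A continuous map `ψ : S → S'` lifts to a map `f` of the universal coverings which carries deck
transformations to deck transformations.  The periods of `E × F` act cocompactly on `ℂ × ℂ`, hence
`f` has bounded increments at bounded distance, and if `f` or its complex conjugate is holomorphic,
Liouville's theorem shows that `f` is affine over the real numbers
(`BagneraDeFranchis.lift_eq_linearMap_add`).

Some deck transformation has `ζ ≠ 1`, because otherwise `F / G` would be the quotient of `F` by a
finite group of translations, which is not the projective line
(`IsUniformization.false_of_translation_fibers`).  The linear part of `f` intertwines the linear maps
`(z, w) ↦ (z, ζ w)`, and therefore it is diagonal.  As `G` acts faithfully by translations on `E`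
and faithfully on `F`, the periods of `E` are exactly the deck transformations which are trivial on
the second factor, and the periods of `F` those which are trivial on the first.  So `f` maps periods
to periods factor by factor and descends to a product of maps of the elliptic curves
(`BagneraDeFranchis.exists_product_lift`).

Applied to `σ`, this gives a lift of `σ` to `E × F`; applied to `ψ` and `ψ⁻¹`, it gives two lifts of
product type, which are inverse to each other up to an element of `G`.  Since `G` is the group of
lifts of the identity, conjugation by the lift `Ψ` of `ψ` carries `G` to `G'` and the lifts of `σ`
to the lifts of `σ'`, which yields the isomorphism of the extended symmetry groups.
-/

/-! ### Holomorphic functions -/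

/-- **Liouville's theorem** for maps with bounded increments: they are affine. -/
theorem exists_eq_continuousLinearMap_add_of_norm_sub_le {V W : Type*}
    [NormedAddCommGroup V] [NormedSpace ℂ V] [NormedAddCommGroup W] [NormedSpace ℂ W]
    [CompleteSpace W] {f : V → W} (hf : Differentiable ℂ f) {C : ℝ}
    (hC : ∀ x y, ‖x - y‖ ≤ 1 → ‖f x - f y‖ ≤ C) :
    ∃ L : V →L[ℂ] W, ∀ v, f v = L v + f 0 := by
  refine ⟨fderiv ℂ f 0, fun v => ?_⟩
  -- on the complex line through `v`, the derivative is bounded, hence constant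
  set h : ℂ → W := fun s => f (s • v) with hh
  have hd : Differentiable ℂ h := by fun_prop
  have hd' : Differentiable ℂ (deriv h) := fun s =>
    ((hd.contDiff (n := 2)).differentiable_deriv_two) s
  set r : ℝ := (‖v‖ + 1)⁻¹ with hr
  have hr0 : 0 < r := by positivity
  have hbound : ∀ s, ‖deriv h s‖ ≤ C / r := by
    intro s
    have h1 : deriv (fun t => h t - h s) s = deriv h s := deriv_sub_const (h s)
    rw [← h1]
    refine Complex.norm_deriv_le_of_forall_mem_sphere_norm_le hr0
      ((hd.sub_const _).diffContOnCl) fun t ht => ?_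
    refine hC _ _ ?_
    rw [← sub_smul, norm_smul, mem_sphere_iff_norm.mp ht, hr]
    rw [inv_mul_le_iff₀ (by positivity)]
    linarith
  have hconst : ∀ s, deriv h s = deriv h 0 := fun s =>
    hd'.apply_eq_apply_of_bounded
      (isBounded_iff_forall_norm_le.mpr ⟨C / r, by rintro _ ⟨s, rfl⟩; exact hbound s⟩) s 0
  have h0 : deriv h 0 = fderiv ℂ f 0 v := by
    have h2 : HasFDerivAt f (fderiv ℂ f 0) ((0 : ℂ) • v) := by
      simpa using (hf 0).hasFDerivAt
    have h3 : HasDerivAt (fun s : ℂ => s • v) v 0 := by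
      simpa using (hasDerivAt_id (0 : ℂ)).smul_const v
    exact (h2.comp_hasDerivAt 0 h3).deriv
  have hz : ∀ s, deriv (fun s => h s - s • deriv h 0) s = 0 := by
    intro s
    have h3 : HasDerivAt (fun s : ℂ => s • deriv h 0) (deriv h 0) s := by
      simpa using (hasDerivAt_id s).smul_const (deriv h 0)
    rw [((hd s).hasDerivAt.fun_sub h3).deriv, hconst s, sub_self]
  have hc := is_const_of_deriv_eq_zero (f := fun s => h s - s • deriv h 0)
    (by fun_prop) hz 1 0
  simp only [hh, one_smul, zero_smul, sub_zero] at hc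
  rw [sub_eq_iff_eq_add'] at hc
  rw [hc, ← h0]

/-- The derivative of a function which is holomorphic and injective near a point does not vanish
there: otherwise the function is, up to a constant, an `n`-th power with `n ≥ 2` of a local
coordinate. -/
theorem AnalyticAt.deriv_ne_zero_of_injOn {v : ℂ → ℂ} {z₀ : ℂ} (hv : AnalyticAt ℂ v z₀)
    {U : Set ℂ} (hU : U ∈ 𝓝 z₀) (hinj : Set.InjOn v U) : deriv v z₀ ≠ 0 := by
  intro hd
  have hf : AnalyticAt ℂ (fun z => v z - v z₀) z₀ := hv.sub analyticAt_const
  have hne : ¬ ∀ᶠ z in 𝓝 z₀, v z - v z₀ = 0 := by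
    intro h
    have h1 : ∀ᶠ z in 𝓝[≠] z₀, False := by
      filter_upwards [h.filter_mono nhdsWithin_le_nhds, mem_nhdsWithin_of_mem_nhds hU,
        self_mem_nhdsWithin] with z hz hzU hzne
      exact hzne (hinj hzU (mem_of_mem_nhds hU) (sub_eq_zero.mp hz))
    exact h1.exists.elim fun _ h => h
  obtain ⟨n, g, hg, hg0, hgn⟩ := (hf.exists_eventuallyEq_pow_smul_nonzero_iff).mpr hne
  have hn0 : n ≠ 0 := by
    rintro rfl
    have := hgn.self_of_nhds
    simp at this
    exact hg0 this.symm
  have hn1 : n ≠ 1 := by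
    rintro rfl
    have h1 : HasDerivAt (fun z => (z - z₀) ^ 1 • g z) (g z₀) z₀ := by
      have h2 := ((hasDerivAt_id z₀).sub_const z₀).fun_mul hg.differentiableAt.hasDerivAt
      simpa using h2
    have h3 : deriv (fun z => v z - v z₀) z₀ = g z₀ := by
      rw [Filter.EventuallyEq.deriv_eq hgn]; exact h1.deriv
    rw [deriv_sub_const, hd] at h3
    exact hg0 h3.symm
  -- `k` is a local coordinate with `v - v z₀ = c * k ^ n`
  set k : ℂ → ℂ := fun z => (z - z₀) * Complex.exp (Complex.log (g z / g z₀) / n) with hk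
  have hlog : AnalyticAt ℂ (fun z => Complex.exp (Complex.log (g z / g z₀) / n)) z₀ := by
    refine AnalyticAt.cexp ?_
    refine AnalyticAt.div (AnalyticAt.clog (hg.div analyticAt_const hg0) ?_) analyticAt_const
      (by exact_mod_cast hn0)
    simp [div_self hg0]
  have hka : AnalyticAt ℂ k z₀ := (analyticAt_id.sub analyticAt_const).mul hlog
  have hkd : HasDerivAt k 1 z₀ := by
    have h2 := ((hasDerivAt_id z₀).sub_const z₀).fun_mul hlog.differentiableAt.hasDerivAt
    simpa [div_self hg0] using h2
  have hks : HasStrictDerivAt k 1 z₀ := by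
    have := hka.hasStrictDerivAt
    rwa [hkd.deriv] at this
  have hmap : Filter.map k (𝓝 z₀) = 𝓝 0 := by
    have := hks.map_nhds_eq one_ne_zero
    simpa [hk] using this
  have hvk : ∀ᶠ z in 𝓝 z₀, v z = v z₀ + g z₀ * k z ^ n := by
    have hgne : ∀ᶠ z in 𝓝 z₀, g z ≠ 0 := hg.continuousAt.eventually_ne hg0
    filter_upwards [hgn, hgne] with z hz hzne
    have : Complex.exp (Complex.log (g z / g z₀) / n) ^ n = g z / g z₀ := by
      rw [← Complex.exp_nat_mul, mul_div_cancel₀ _ (by exact_mod_cast hn0),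
        Complex.exp_log (div_ne_zero hzne hg0)]
    rw [hk]
    simp only [mul_pow, this]
    rw [smul_eq_mul] at hz
    field_simp
    linear_combination hz
  set V : Set ℂ := U ∩ {z | v z = v z₀ + g z₀ * k z ^ n} with hV
  have hVn : k '' V ∈ 𝓝 (0 : ℂ) := by
    rw [← hmap]
    exact Filter.image_mem_map (Filter.inter_mem hU hvk)
  have hprim := Complex.isPrimitiveRoot_exp n hn0
  set ζ := Complex.exp (2 * Real.pi * Complex.I / n)
  have hζ1 : ζ ≠ 1 := hprim.ne_one (by omega)
  have hVn' : (fun z => ζ * z) ⁻¹' (k '' V) ∈ 𝓝 (0 : ℂ) := by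
    refine (Continuous.continuousAt (by fun_prop) : ContinuousAt (fun z => ζ * z) 0) ?_
    simpa using hVn
  obtain ⟨t, ⟨⟨x, hxV, hx⟩, ⟨y, hyV, hy⟩⟩, ht⟩ : ∃ t, t ∈ k '' V ∩ (fun z => ζ * z) ⁻¹' (k '' V) ∧
      t ≠ 0 := by
    have h1 : ∀ᶠ t in 𝓝[≠] (0 : ℂ), t ∈ k '' V ∩ (fun z => ζ * z) ⁻¹' (k '' V) ∧ t ≠ 0 := by
      filter_upwards [mem_nhdsWithin_of_mem_nhds (Filter.inter_mem hVn hVn'),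
        self_mem_nhdsWithin] with t h1 h2 using ⟨h1, h2⟩
    exact h1.exists
  have hxy : v x = v y := by
    rw [hxV.2, hyV.2, hx, hy, mul_pow, hprim.pow_eq_one, one_mul]
  have := hinj hxV.1 hyV.1 hxy
  rw [this, hy] at hx
  have h2 : (ζ - 1) * t = 0 := by linear_combination hx
  rcases mul_eq_zero.mp h2 with h | h
  · exact hζ1 (sub_eq_zero.mp h)
  · exact ht h

/-! ### The universal covering of an elliptic curve -/

/-- `p` presents `E` as the quotient of `ℂ` by a lattice, and is locally biholomorphic. -/
structure IsUniformization {E : Type*} [TopologicalSpace E] [ChartedSpace ℂ E] [AddCommGroup E]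
    (p : ℂ →+ E) : Prop where
  isLocalDiffeomorph : IsLocalDiffeomorph 𝓘(ℂ) 𝓘(ℂ) ω p
  surjective : Function.Surjective p
  exists_lattice : ∃ (Λ : Submodule ℤ ℂ) (_ : DiscreteTopology Λ) (_ : IsZLattice ℝ Λ),
    ∀ z : ℂ, p z = 0 ↔ z ∈ Λ

theorem IsEllipticCurve.exists_isUniformization {E : Type*} [TopologicalSpace E] [ChartedSpace ℂ E]
    [AddCommGroup E] (hE : IsEllipticCurve E) : ∃ p : ℂ →+ E, IsUniformization p := by
  obtain ⟨Λ, h1, h2, p, hp, hs, hk⟩ := hE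
  exact ⟨p, hp, hs, Λ, h1, h2, hk⟩

namespace IsUniformization

section

variable {E : Type*} [TopologicalSpace E] [ChartedSpace ℂ E] [AddCommGroup E]
  {p : ℂ →+ E} (hp : IsUniformization p)
include hp

theorem continuous : Continuous p := hp.isLocalDiffeomorph.contMDiff.continuous

theorem isQuotientMap : Topology.IsQuotientMap p :=
  hp.isLocalDiffeomorph.isOpenMap.isQuotientMap hp.continuous hp.surjective

theorem isDiscrete_ker : IsDiscrete (p.ker : Set ℂ) := by
  obtain ⟨Λ, h1, h2, hk⟩ := hp.exists_lattice
  have : (p.ker : Set ℂ) = Λ := by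
    ext z
    simp [AddMonoidHom.mem_ker, hk]
  rw [this]
  exact isDiscrete_iff_discreteTopology.mpr h1

theorem isCoveringMap : IsCoveringMap p :=
  (hp.isQuotientMap.isAddQuotientCoveringMap_of_isDiscrete_ker_addMonoidHom
    hp.isDiscrete_ker).isCoveringMap

theorem connectedSpace : ConnectedSpace E :=
  hp.surjective.connectedSpace hp.continuous

/-- Every complex number is congruent to a number of bounded absolute value modulo the periods. -/
theorem exists_norm_sub_le : ∃ r : ℝ, ∀ z : ℂ, ∃ l : ℂ, p l = 0 ∧ ‖z - l‖ ≤ r := by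
  obtain ⟨Λ, h1, h2, hk⟩ := hp.exists_lattice
  have := ZLattice.module_free ℝ Λ
  have := ZLattice.module_finite ℝ Λ
  set b := (Module.Free.chooseBasis ℤ Λ).ofZLatticeBasis ℝ Λ with hb
  refine ⟨∑ i, ‖b i‖, fun z => ⟨ZSpan.floor b z, ?_, ZSpan.norm_fract_le b z⟩⟩
  rw [hk]
  exact (Module.Basis.ofZLatticeBasis_span ℝ Λ (Module.Free.chooseBasis ℤ Λ)).le
    (ZSpan.floor b z).2

theorem exists_continuous_lift {A : Type*} [TopologicalSpace A] [SimplyConnectedSpace A]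
    [LocallyPathConnectedSpace A] {f : A → E} (hf : Continuous f) :
    ∃ F : A → ℂ, Continuous F ∧ ∀ a, p (F a) = f a := by
  obtain ⟨a₀⟩ : Nonempty A := inferInstance
  obtain ⟨e₀, he⟩ := hp.surjective (f a₀)
  obtain ⟨F, hF, -⟩ :=
    hp.isCoveringMap.existsUnique_continuousMap_lifts ⟨f, hf⟩ a₀ e₀ he
  exact ⟨F, F.continuous, fun a => congrFun hF.2 a⟩

theorem eq_of_lifts {A : Type*} [TopologicalSpace A] [PreconnectedSpace A] {f g : A → ℂ}
    (hf : Continuous f) (hg : Continuous g) (h : ∀ a, p (f a) = p (g a)) (a₀ : A)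
    (h₀ : f a₀ = g a₀) : f = g :=
  hp.isCoveringMap.eq_of_comp_eq hf hg (funext h) a₀ h₀

end

variable {E : Type*} [TopologicalSpace E] [ChartedSpace ℂ E] [AddCommGroup E]
  [LieAddGroup 𝓘(ℂ) ω E] {p : ℂ →+ E} (hp : IsUniformization p)
include hp

theorem t2Space : T2Space E := by
  have : IsTopologicalAddGroup E := topologicalAddGroup_of_lieAddGroup 𝓘(ℂ) ω
  have h0 : IsClosed ({0} : Set E) := by
    rw [← hp.isQuotientMap.isClosed_preimage]
    have : p ⁻¹' {0} = (p.ker : Set ℂ) := by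
      ext z
      simp [AddMonoidHom.mem_ker]
    rw [this]
    have : DiscreteTopology p.ker := isDiscrete_iff_discreteTopology.mp hp.isDiscrete_ker
    exact AddSubgroup.isClosed_of_discrete
  have := IsTopologicalAddGroup.t1Space E h0
  infer_instance

end IsUniformization

theorem IsLocalDiffeomorphAt.exists_leftInverse {𝕜 E F H H' M N : Type*}
    [NontriviallyNormedField 𝕜] [NormedAddCommGroup E] [NormedSpace 𝕜 E]
    [NormedAddCommGroup F] [NormedSpace 𝕜 F] [TopologicalSpace H] [TopologicalSpace H']
    [TopologicalSpace M] [TopologicalSpace N] [ChartedSpace H M] [ChartedSpace H' N]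
    {I : ModelWithCorners 𝕜 E H} {J : ModelWithCorners 𝕜 F H'} {n : WithTop ℕ∞} {f : M → N} {x : M}
    (hf : IsLocalDiffeomorphAt I J n f x) :
    ∃ k : N → M, ContMDiffAt J I n k (f x) ∧ ∀ᶠ y in 𝓝 x, k (f y) = y :=
  ⟨hf.localInverse, hf.localInverse_contMDiffAt, hf.localInverse_eventuallyEq_left⟩

/-- A continuous lift of a smooth map through a local diffeomorphism is smooth. -/
theorem IsLocalDiffeomorph.contMDiff_of_comp {𝕜 E F G H H' H'' M N P : Type*}
    [NontriviallyNormedField 𝕜] [NormedAddCommGroup E] [NormedSpace 𝕜 E]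
    [NormedAddCommGroup F] [NormedSpace 𝕜 F] [NormedAddCommGroup G] [NormedSpace 𝕜 G]
    [TopologicalSpace H] [TopologicalSpace H'] [TopologicalSpace H'']
    [TopologicalSpace M] [TopologicalSpace N] [TopologicalSpace P]
    [ChartedSpace H M] [ChartedSpace H' N] [ChartedSpace H'' P]
    {I : ModelWithCorners 𝕜 E H} {J : ModelWithCorners 𝕜 F H'} {K : ModelWithCorners 𝕜 G H''}
    {n : WithTop ℕ∞} {q : M → N} (hq : IsLocalDiffeomorph I J n q)
    {f : P → M} (hf : Continuous f) (hqf : ContMDiff K J n (q ∘ f)) : ContMDiff K I n f := by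
  intro x
  obtain ⟨k, hk, hkq⟩ := (hq (f x)).exists_leftInverse
  have h1 : ContMDiffAt K I n (k ∘ (q ∘ f)) x := hk.comp x (hqf x)
  refine h1.congr_of_eventuallyEq ?_
  filter_upwards [hf.continuousAt.eventually hkq] with y hy using hy.symm

/-! ### The universal covering of the surface -/

namespace BagneraDeFranchis

variable {E F S : Type*}
  [TopologicalSpace E] [ChartedSpace ℂ E] [AddCommGroup E]
  [TopologicalSpace F] [ChartedSpace ℂ F]
  [TopologicalSpace S] [ChartedSpace (ℂ × ℂ) S]

theorem continuous_π (R : BagneraDeFranchis E F S) : Continuous R.π :=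
  R.localBiholomorphic_π.contMDiff.continuous

theorem isLocallyInjective_π (R : BagneraDeFranchis E F S) : IsLocallyInjective R.π :=
  R.localBiholomorphic_π.isLocalHomeomorph.isLocallyInjective

theorem eq_of_lifts [T2Space E] [T2Space F] (R : BagneraDeFranchis E F S) {A : Type*}
    [TopologicalSpace A] [PreconnectedSpace A] {f g : A → E × F}
    (hf : Continuous f) (hg : Continuous g) (h : ∀ a, R.π (f a) = R.π (g a)) (a₀ : A)
    (h₀ : f a₀ = g a₀) : f = g :=
  (T2Space.isSeparatedMap R.π).eq_of_comp_eq R.isLocallyInjective_π hf hg (funext h) a₀ h₀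

variable [LieAddGroup 𝓘(ℂ) ω E]

@[simp]
theorem action_apply (R : BagneraDeFranchis E F S) (g : Multiplicative R.G) (x : E × F) :
    R.action g x = ((Multiplicative.toAdd g : R.G) + x.1, R.ρ g x.2) := rfl

theorem π_action (R : BagneraDeFranchis E F S) (g : Multiplicative R.G) (x : E × F) :
    R.π (R.action g x) = R.π x :=
  ((R.π_eq_iff _ _).mpr ⟨Multiplicative.toAdd g, rfl⟩).symm

theorem exists_action_eq (R : BagneraDeFranchis E F S) {x y : E × F} (h : R.π x = R.π y) :
    ∃ g, y = R.action g x := by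
  obtain ⟨g, hg⟩ := (R.π_eq_iff x y).mp h
  exact ⟨Multiplicative.ofAdd g, hg⟩

/-- The quotient map `E × F → S` is a covering map, since `G` acts freely on the first factor. -/
theorem isCoveringMap_π [T2Space E] (R : BagneraDeFranchis E F S) : IsCoveringMap R.π := by
  have : IsTopologicalAddGroup E := topologicalAddGroup_of_lieAddGroup 𝓘(ℂ) ω
  let : MulAction (Multiplicative R.G) (E × F) :=
    { smul := fun g x => R.action g x
      one_smul := fun x => by change R.action 1 x = x; rw [map_one]; rfl
      mul_smul := fun g h x => by
        change R.action (g * h) x = R.action g (R.action h x); rw [map_mul]; rfl }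
  have hG : IsDiscrete (R.G : Set E) := by
    have := R.finite_G
    have : Finite (R.G : Set E) := this
    exact (Set.toFinite _).isDiscrete
  have hq : Topology.IsQuotientMap R.π :=
    R.localBiholomorphic_π.isOpenMap.isQuotientMap R.continuous_π R.surjective_π
  have hcov : IsQuotientCoveringMap R.π (Multiplicative R.G) :=
    { toIsQuotientMap := hq
      continuous_const_smul := fun g => (R.action g).continuous
      apply_eq_iff_mem_orbit := by
        intro x y
        constructor
        · intro h
          obtain ⟨g, hg⟩ := R.exists_action_eq h.symm
          exact ⟨g, hg.symm⟩
        · rintro ⟨g, rfl⟩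
          exact R.π_action g y
      disjoint := by
        intro x
        obtain ⟨U, hU, h⟩ := (AddSubgroup.isAddQuotientCoveringMap_of_comm R.G hG).disjoint x.1
        refine ⟨Prod.fst ⁻¹' U, continuous_fst.continuousAt hU, fun g hg => ?_⟩
        obtain ⟨_, ⟨y, hy, rfl⟩, hy'⟩ := hg
        exact h (Multiplicative.toAdd g) ⟨_, ⟨y.1, hy, rfl⟩, hy'⟩ }
  exact hcov.isCoveringMap

end BagneraDeFranchis

/-! ### Deck transformations -/

/-- A continuous map whose increments are unchanged under a cocompact set of translations of the
source has bounded increments at bounded distance. -/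
theorem exists_norm_sub_le_of_translations {V W : Type*} [NormedAddCommGroup V] [ProperSpace V]
    [NormedAddCommGroup W] {f : V → W} (hf : Continuous f) {R : ℝ}
    (h : ∀ x, ∃ t, ‖x - t‖ ≤ R ∧ ∀ u v, ‖f (u + t) - f (v + t)‖ = ‖f u - f v‖) :
    ∃ C, ∀ x y, ‖x - y‖ ≤ 1 → ‖f x - f y‖ ≤ C := by
  obtain ⟨M, hM⟩ := (isCompact_closedBall (0 : V) (R + 1)).exists_bound_of_continuousOn
    hf.continuousOn
  refine ⟨M + M, fun x y hxy => ?_⟩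
  obtain ⟨t, ht, hft⟩ := h x
  have h1 := hft (x - t) (y - t)
  rw [sub_add_cancel, sub_add_cancel] at h1
  rw [h1]
  have hy : ‖y - t‖ ≤ R + 1 := by
    calc ‖y - t‖ = ‖(x - t) - (x - y)‖ := by congr 1; abel
      _ ≤ ‖x - t‖ + ‖x - y‖ := norm_sub_le _ _
      _ ≤ R + 1 := add_le_add ht hxy
  exact (norm_sub_le _ _).trans (add_le_add (hM _ (by simpa using ht.trans (by linarith)))
    (hM _ (by simpa using hy)))

/-- A holomorphic automorphism of finite order of an elliptic curve is induced by an affine map of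
`ℂ` whose linear part has absolute value one. -/
theorem IsUniformization.exists_affine_lift {F : Type*} [TopologicalSpace F] [ChartedSpace ℂ F]
    [AddCommGroup F] {r : ℂ →+ F} (hr : IsUniformization r) {h : F → F}
    (hh : ContMDiff 𝓘(ℂ) 𝓘(ℂ) ω h) {n : ℕ} (hn : n ≠ 0) (hhn : h^[n] = id) :
    ∃ ζ b : ℂ, ‖ζ‖ = 1 ∧ ∀ w, r (ζ * w + b) = h (r w) := by
  obtain ⟨k, hk, hkr⟩ := hr.exists_continuous_lift (hh.continuous.comp hr.continuous)
  have hkd : Differentiable ℂ k := by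
    have h1 : ContMDiff 𝓘(ℂ) 𝓘(ℂ) ω (r ∘ k) := by
      rw [show r ∘ k = h ∘ r from funext hkr]
      exact hh.comp hr.isLocalDiffeomorph.contMDiff
    exact (hr.isLocalDiffeomorph.contMDiff_of_comp hk h1).contDiff.differentiable (by simp)
  have hkl : ∀ l, r l = 0 → ∀ u, k (u + l) = k u + (k l - k 0) := by
    intro l hl u
    refine congrFun (hr.eq_of_lifts (f := fun u => k (u + l)) (g := fun u => k u + (k l - k 0))
      (by fun_prop) (by fun_prop) (fun u => ?_) 0 (by simp)) u
    simp [hkr, hl]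
  obtain ⟨R, hR⟩ := hr.exists_norm_sub_le
  obtain ⟨C, hC⟩ := exists_norm_sub_le_of_translations hk (R := R) fun x => by
    obtain ⟨l, hl, hxl⟩ := hR x
    refine ⟨l, hxl, fun u v => ?_⟩
    rw [hkl l hl, hkl l hl, add_sub_add_right_eq_sub]
  obtain ⟨L, hL⟩ := exists_eq_continuousLinearMap_add_of_norm_sub_le hkd hC
  have hk1 : ∀ w, k w = L 1 * w + k 0 := fun w => by
    rw [hL w]
    congr 1
    simpa [mul_comm] using L.map_smul w 1
  refine ⟨L 1, k 0, ?_, fun w => by rw [← hk1, hkr]; rfl⟩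
  -- the `n`-th iterate of the lift is a lift of the identity, hence a translation
  have hiter : ∀ m w, k^[m] w = L 1 ^ m * w + k^[m] 0 := by
    intro m
    induction m with
    | zero => simp
    | succ m ih =>
      intro w
      rw [Function.iterate_succ_apply', Function.iterate_succ_apply', hk1 (k^[m] w),
        hk1 (k^[m] 0), ih w]
      ring
  have hriter : ∀ m w, r (k^[m] w) = h^[m] (r w) := fun m w =>
    (Function.Semiconj.iterate_right (f := r) (ga := k) (gb := h) hkr m) w
  have htrans : k^[n] = fun w => w + k^[n] 0 := by
    refine hr.eq_of_lifts (hk.iterate n) (by fun_prop) (fun w => ?_) 0 (by simp)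
    rw [map_add, hriter, hriter, hhn]
    simp
  have h1 : L 1 ^ n = 1 := by
    have h2 := congrFun htrans 1
    rw [hiter n 1] at h2
    simpa using h2
  exact Complex.norm_eq_one_of_pow_eq_one h1 hn

namespace BagneraDeFranchis

variable {E F S : Type*}
  [TopologicalSpace E] [ChartedSpace ℂ E] [AddCommGroup E]
  [TopologicalSpace F] [ChartedSpace ℂ F] [AddCommGroup F]
  [TopologicalSpace S] [ChartedSpace (ℂ × ℂ) S]

/-- The map `(z, w) ↦ (z + a, ζ w + b)` is a deck transformation of the universal covering
`ℂ × ℂ → S` which lies over `g ∈ G`.  The transformation is encoded by the parameters `a`, `ζ` and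
`b`; that `ζ` has absolute value one makes it an isometry. -/
structure IsDeck (R : BagneraDeFranchis E F S) (p : ℂ →+ E) (r : ℂ →+ F) (g : Multiplicative R.G)
    (a ζ b : ℂ) : Prop where
  norm_eq_one : ‖ζ‖ = 1
  apply_fst : p a = (Multiplicative.toAdd g : R.G)
  apply_snd : ∀ w, r (ζ * w + b) = R.ρ g (r w)

/-- The universal covering `ℂ × ℂ → S` of the surface, for uniformizations `p` of `E` and `r` of
`F`. -/
def cover (R : BagneraDeFranchis E F S) (p : ℂ →+ E) (r : ℂ →+ F) (x : ℂ × ℂ) : S :=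
  R.π (p x.1, r x.2)

variable {p : ℂ →+ E} {r : ℂ →+ F} (hp : IsUniformization p) (hr : IsUniformization r)
  (R : BagneraDeFranchis E F S)

include hp hr in
theorem continuous_cover : Continuous (R.cover p r) := by
  have := hp.continuous
  have := hr.continuous
  have := R.continuous_π
  unfold cover
  fun_prop

theorem IsDeck.cover_eq {R : BagneraDeFranchis E F S} {g : Multiplicative R.G} {a ζ b : ℂ}
    (h : R.IsDeck p r g a ζ b) (x : ℂ × ℂ) :
    R.cover p r (x.1 + a, ζ * x.2 + b) = R.cover p r x := by
  refine ((R.π_eq_iff _ _).mpr ⟨Multiplicative.toAdd g, ?_⟩).symm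
  simp only [map_add p, h.apply_fst, add_comm]
  rw [add_comm b, h.apply_snd]
  rfl

theorem isDeck_fst {l : ℂ} (hl : p l = 0) : R.IsDeck p r 1 l 1 0 :=
  ⟨by simp, by simp [hl], by simp⟩

theorem isDeck_snd {l : ℂ} (hl : r l = 0) : R.IsDeck p r 1 0 1 l :=
  ⟨by simp, by simp, by simp [hl]⟩

include hr in
theorem exists_isDeck_ρ (g : Multiplicative R.G) :
    ∃ ζ b : ℂ, ‖ζ‖ = 1 ∧ ∀ w, r (ζ * w + b) = R.ρ g (r w) := by
  have := R.finite_G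
  have hfin : IsOfFinOrder g := isOfFinOrder_of_finite g
  refine hr.exists_affine_lift (R.holomorphic_ρ g) (n := orderOf g) hfin.orderOf_pos.ne' ?_
  have h1 : ∀ m : ℕ, (R.ρ g)^[m] = R.ρ (g ^ m) := by
    intro m
    induction m with
    | zero => ext; simp
    | succ m ih => ext x; rw [Function.iterate_succ_apply', ih, pow_succ', map_mul]; rfl
  rw [h1, pow_orderOf_eq_one, map_one]
  rfl

include hr in
theorem exists_isDeck_of_cover_eq {x y : ℂ × ℂ} (h : R.cover p r x = R.cover p r y) :
    ∃ g a ζ b, R.IsDeck p r g a ζ b ∧ y = (x.1 + a, ζ * x.2 + b) := by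
  obtain ⟨g, hg⟩ := (R.π_eq_iff _ _).mp h
  rw [Prod.mk.injEq] at hg
  obtain ⟨ζ, b, hζ, hb⟩ := R.exists_isDeck_ρ hr (Multiplicative.ofAdd g)
  refine ⟨Multiplicative.ofAdd g, y.1 - x.1, ζ, y.2 - ζ * x.2, ⟨hζ, ?_, fun w => ?_⟩, ?_⟩
  · rw [map_sub, hg.1]; simp
  · have h1 := hb x.2
    rw [← hg.2] at h1
    have h2 : ζ * w + (y.2 - ζ * x.2) = (ζ * w + b) + (y.2 - (ζ * x.2 + b)) := by ring
    rw [h2, map_add, map_sub, h1, sub_self, add_zero, hb]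
  · ext <;> simp

/-- A deck transformation which is trivial on `E` is a period of `F`, since `G` is a group of
translations of `E`. -/
theorem IsDeck.eq_one_of_fst {R : BagneraDeFranchis E F S} {g : Multiplicative R.G} {a ζ b : ℂ}
    (h : R.IsDeck p r g a ζ b) (ha : p a = 0) : g = 1 := by
  have h1 := h.apply_fst
  rw [ha] at h1
  exact Multiplicative.toAdd.injective (Subtype.ext h1.symm)

include hr in
/-- A deck transformation which is trivial on `F` is a period of `E`, since `G` acts faithfully on
`F`. -/
theorem IsDeck.eq_one_of_snd {R : BagneraDeFranchis E F S} {g : Multiplicative R.G} {a b : ℂ}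
    (h : R.IsDeck p r g a 1 b) (hb : r b = 0) : g = 1 := by
  apply R.faithful_ρ
  ext x
  obtain ⟨w, rfl⟩ := hr.surjective x
  rw [← h.apply_snd w]
  simp [hb]

include hp hr in
theorem eq_of_cover_lifts [T2Space E] [T2Space F] {A : Type*} [TopologicalSpace A]
    [PreconnectedSpace A] {f g : A → ℂ × ℂ} (hf : Continuous f) (hg : Continuous g)
    (h : ∀ a, R.cover p r (f a) = R.cover p r (g a)) (a₀ : A) (h₀ : f a₀ = g a₀) : f = g := by
  have hpc := hp.continuous
  have hrc := hr.continuous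
  have h1 : (fun a => (p (f a).1, r (f a).2)) = fun a => (p (g a).1, r (g a).2) :=
    R.eq_of_lifts (by fun_prop) (by fun_prop) h a₀ (by rw [h₀])
  have h2 := hp.eq_of_lifts (f := fun a => (f a).1) (g := fun a => (g a).1) (by fun_prop)
    (by fun_prop) (fun a => congrArg Prod.fst (congrFun h1 a)) a₀ (by rw [h₀])
  have h3 := hr.eq_of_lifts (f := fun a => (f a).2) (g := fun a => (g a).2) (by fun_prop)
    (by fun_prop) (fun a => congrArg Prod.snd (congrFun h1 a)) a₀ (by rw [h₀])
  exact funext fun a => Prod.ext (congrFun h2 a) (congrFun h3 a)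

include hp hr in
theorem exists_cover_lift [LieAddGroup 𝓘(ℂ) ω E] [T2Space E] {A : Type*} [TopologicalSpace A]
    [SimplyConnectedSpace A] [LocallyPathConnectedSpace A] {f : A → S} (hf : Continuous f) :
    ∃ k : A → ℂ × ℂ, Continuous k ∧ ∀ a, R.cover p r (k a) = f a := by
  obtain ⟨a₀⟩ : Nonempty A := inferInstance
  obtain ⟨e₀, he⟩ := R.surjective_π (f a₀)
  obtain ⟨H, hH, -⟩ := R.isCoveringMap_π.existsUnique_continuousMap_lifts ⟨f, hf⟩ a₀ e₀ he
  obtain ⟨k₁, hk₁, h₁⟩ := hp.exists_continuous_lift (continuous_fst.comp H.continuous)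
  obtain ⟨k₂, hk₂, h₂⟩ := hr.exists_continuous_lift (continuous_snd.comp H.continuous)
  refine ⟨fun a => (k₁ a, k₂ a), by fun_prop, fun a => ?_⟩
  rw [cover, h₁, h₂]
  exact congrFun hH.2 a

end BagneraDeFranchis

/-! ### Maps to the projective line -/

/-- `s` is a pair of holomorphic homogeneous coordinates for `Q` near `z`. -/
def IsHomogeneousLift (Q : ℂ → Projectivization ℂ (Fin 2 → ℂ)) (s : ℂ → Fin 2 → ℂ) (z : ℂ) : Prop :=
  AnalyticAt ℂ s z ∧ ∀ᶠ y in 𝓝 z, ∃ hs : s y ≠ 0, Q y = Projectivization.mk ℂ (s y) hs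

/-- The Wronskian of the pair of functions `s`. -/
noncomputable def pairWronskian (s : ℂ → Fin 2 → ℂ) (z : ℂ) : ℂ :=
  s z 0 * deriv (fun y => s y 1) z - s z 1 * deriv (fun y => s y 0) z

namespace IsHomogeneousLift

variable {Q : ℂ → Projectivization ℂ (Fin 2 → ℂ)} {s t : ℂ → Fin 2 → ℂ} {z : ℂ}

theorem analyticAt_apply (hs : IsHomogeneousLift Q s z) (i : Fin 2) :
    AnalyticAt ℂ (fun y => s y i) z :=
  analyticAt_pi_iff.mp hs.1 i

theorem analyticAt_pairWronskian (hs : IsHomogeneousLift Q s z) :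
    AnalyticAt ℂ (pairWronskian s) z :=
  ((hs.analyticAt_apply 0).mul (hs.analyticAt_apply 1).deriv).sub
    ((hs.analyticAt_apply 1).mul (hs.analyticAt_apply 0).deriv)

theorem eventually (hs : IsHomogeneousLift Q s z) : ∀ᶠ y in 𝓝 z, IsHomogeneousLift Q s y :=
  hs.1.eventually_analyticAt.and hs.2.eventually_nhds

/-- Up to the factor `s z i ^ 2`, this is the derivative of `s j / s i`, an injective function. -/
theorem wronskian_ne_zero_of_ne_zero (hs : IsHomogeneousLift Q s z) {U : Set ℂ} (hU : U ∈ 𝓝 z)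
    (hQ : Set.InjOn Q U) {i j : Fin 2} (hij : ∀ k, k = i ∨ k = j) (hi : s z i ≠ 0) :
    s z i * deriv (fun y => s y j) z - s z j * deriv (fun y => s y i) z ≠ 0 := by
  have hai := hs.analyticAt_apply i
  have haj := hs.analyticAt_apply j
  have hne : ∀ᶠ y in 𝓝 z, s y i ≠ 0 := hai.continuousAt.eventually_ne hi
  have hV : U ∩ {y | (∃ h : s y ≠ 0, Q y = Projectivization.mk ℂ (s y) h) ∧ s y i ≠ 0} ∈ 𝓝 z :=
    Filter.inter_mem hU (hs.2.and hne)
  have h1 := (haj.div hai hi).deriv_ne_zero_of_injOn hV (by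
    rintro x ⟨hxU, ⟨hx, hQx⟩, hxi⟩ y ⟨hyU, ⟨hy, hQy⟩, hyi⟩ hxy
    refine hQ hxU hyU ?_
    rw [hQx, hQy, Projectivization.mk_eq_mk_iff']
    refine ⟨s x i / s y i, ?_⟩
    simp only [Pi.div_apply] at hxy
    ext k
    rcases hij k with rfl | rfl
    · simp [div_mul_cancel₀ _ hyi]
    · simp only [Pi.smul_apply, smul_eq_mul]
      field_simp at hxy ⊢
      linear_combination -hxy)
  have h2 : deriv ((fun y => s y j) / fun y => s y i) z =
      (deriv (fun y => s y j) z * s z i - s z j * deriv (fun y => s y i) z) / s z i ^ 2 :=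
    (haj.differentiableAt.hasDerivAt.div hai.differentiableAt.hasDerivAt hi).deriv
  rw [h2] at h1
  have h3 := (div_ne_zero_iff.mp h1).1
  rwa [mul_comm (deriv _ _)] at h3

theorem pairWronskian_ne_zero (hs : IsHomogeneousLift Q s z) {U : Set ℂ} (hU : U ∈ 𝓝 z)
    (hQ : Set.InjOn Q U) : pairWronskian s z ≠ 0 := by
  obtain ⟨hz, -⟩ := hs.2.self_of_nhds
  obtain ⟨i, hi⟩ := Function.ne_iff.mp hz
  fin_cases i
  · exact hs.wronskian_ne_zero_of_ne_zero hU hQ (i := 0) (j := 1) (by decide) hi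
  · have := hs.wronskian_ne_zero_of_ne_zero hU hQ (i := 1) (j := 0) (by decide) hi
    rw [pairWronskian, ← neg_sub]
    exact neg_ne_zero.mpr this

/-- The quotient `s₀ ^ 2 / W(s₀, s₁)`, the reciprocal of the derivative of `s₁ / s₀`, does not
depend on the choice of the homogeneous coordinates. -/
theorem sq_div_pairWronskian_eq (hs : IsHomogeneousLift Q s z) (ht : IsHomogeneousLift Q t z) :
    s z 0 ^ 2 / pairWronskian s z = t z 0 ^ 2 / pairWronskian t z := by
  have hst : ∀ᶠ y in 𝓝 z, ∃ c : ℂ, c ≠ 0 ∧ s y = c • t y := by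
    filter_upwards [hs.2, ht.2] with y ⟨h1, h2⟩ ⟨h3, h4⟩
    obtain ⟨c, hc⟩ := (Projectivization.mk_eq_mk_iff' ℂ _ _ h1 h3).mp (h2.symm.trans h4)
    refine ⟨c, ?_, hc.symm⟩
    rintro rfl
    exact h1 (by rw [← hc, zero_smul])
  have hcross : (fun y => s y 0 * t y 1) =ᶠ[𝓝 z] fun y => s y 1 * t y 0 := by
    filter_upwards [hst] with y hy
    obtain ⟨c, -, hc⟩ := hy
    simp only [hc, Pi.smul_apply, smul_eq_mul]
    ring
  have hd := hcross.deriv_eq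
  have ds := fun i => (hs.analyticAt_apply i).differentiableAt.hasDerivAt
  have dt := fun i => (ht.analyticAt_apply i).differentiableAt.hasDerivAt
  rw [((ds 0).fun_mul (dt 1)).deriv, ((ds 1).fun_mul (dt 0)).deriv] at hd
  obtain ⟨c, hc0, hc⟩ := hst.self_of_nhds
  have h0 : s z 0 = c * t z 0 := by rw [hc]; rfl
  have h1 : s z 1 = c * t z 1 := by rw [hc]; rfl
  have hW : pairWronskian s z = c ^ 2 * pairWronskian t z := by
    simp only [pairWronskian]
    rw [h0, h1] at hd ⊢
    linear_combination (-c) * hd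
  rw [hW, h0, mul_pow, mul_div_mul_left _ _ (pow_ne_zero 2 hc0)]

theorem comp_sub (hs : IsHomogeneousLift Q s z) {l : ℂ} (hl : ∀ y, Q (y + l) = Q y) :
    IsHomogeneousLift Q (fun y => s (y - l)) (z + l) := by
  have h1 : Filter.Tendsto (fun y => y - l) (𝓝 (z + l)) (𝓝 z) := by
    have : ContinuousAt (fun y => y - l) (z + l) := by fun_prop
    simpa [ContinuousAt] using this
  refine ⟨?_, ?_⟩
  · refine AnalyticAt.fun_comp (g := s) (f := fun y => y - l) ?_ (analyticAt_id.sub analyticAt_const)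
    simpa using hs.1
  · filter_upwards [h1.eventually hs.2] with y ⟨hy, hQ⟩
    exact ⟨hy, by rw [← hQ, ← hl (y - l), sub_add_cancel]⟩

end IsHomogeneousLift

/-- The quotient of an elliptic curve by a finite group of translations is not the projective line.
Otherwise the reciprocal of the derivative of the quotient map, seen as a meromorphic function on
`ℂ`, would be entire and periodic, hence constant, although it vanishes exactly at the poles. -/
theorem IsUniformization.false_of_translation_fibers {F : Type*} [TopologicalSpace F]
    [ChartedSpace ℂ F] [AddCommGroup F] [T2Space F] {r : ℂ →+ F} (hr : IsUniformization r)
    {T : Set F} (hT : T.Finite) {q : F → Projectivization ℂ (Fin 2 → ℂ)}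
    (hq : IsHolomorphicToP1 q) (hqs : Function.Surjective q)
    (hqT : ∀ x y, q x = q y → ∃ c ∈ T, y = x + c) : False := by
  set Q : ℂ → Projectivization ℂ (Fin 2 → ℂ) := fun z => q (r z) with hQ
  have hlift : ∀ z, ∃ s, IsHomogeneousLift Q s z := by
    intro z
    obtain ⟨s, hs, hsq⟩ := hq (r z)
    refine ⟨fun y => s (r y), ?_, hr.continuous.continuousAt.eventually hsq⟩
    have h1 : ContMDiffAt 𝓘(ℂ) 𝓘(ℂ, Fin 2 → ℂ) ω (s ∘ r) z :=
      hs.comp z (hr.isLocalDiffeomorph.contMDiff z)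
    exact h1.contDiffAt.analyticAt
  -- distinct points of a fibre of `Q` do not come close to each other
  have hinj : ∀ z, ∃ U ∈ 𝓝 z, Set.InjOn Q U := by
    intro z
    have hsub : Filter.Tendsto (fun x : ℂ × ℂ => x.2 - x.1) (𝓝 z ×ˢ 𝓝 z) (𝓝 0) := by
      have : ContinuousAt (fun x : ℂ × ℂ => x.2 - x.1) (z, z) := by fun_prop
      simpa [ContinuousAt, nhds_prod_eq] using this
    have h1 : ∀ᶠ x in 𝓝 (0 : ℂ), r x ∉ T \ {0} := by
      refine (hr.continuous.continuousAt (x := 0)).preimage_mem_nhds (t := (T \ {0})ᶜ) ?_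
      rw [map_zero]
      exact (hT.subset Set.sdiff_subset).isClosed.isOpen_compl.mem_nhds (by simp)
    have h2 : ∀ᶠ x in 𝓝 (0 : ℂ), r x = 0 → x = 0 := by
      obtain ⟨V, hV, h0, hVi⟩ := hr.isLocalDiffeomorph.isLocalHomeomorph.isLocallyInjective 0
      filter_upwards [hV.mem_nhds h0] with x hx h
      exact hVi hx h0 (by rw [h, map_zero])
    obtain ⟨U, hU, hUU⟩ := Filter.mem_prod_same_iff.mp (hsub.eventually (h1.and h2))
    refine ⟨U, hU, fun x hx y hy hxy => ?_⟩
    obtain ⟨h3, h4⟩ := hUU (Set.mk_mem_prod hx hy)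
    obtain ⟨c, hc, hyc⟩ := hqT _ _ hxy
    have h5 : r (y - x) = c := by rw [map_sub, hyc, add_sub_cancel_left]
    have h6 : r (y - x) = 0 := by
      by_contra h
      exact h3 ⟨h5 ▸ hc, h⟩
    exact (sub_eq_zero.mp (h4 h6)).symm
  choose s hs using hlift
  -- the reciprocal of the derivative of `Q`, written so that it makes sense at the poles of `Q`
  set e : ℂ → ℂ := fun z => s z z 0 ^ 2 / pairWronskian (s z) z with he
  have heq : ∀ {t z}, IsHomogeneousLift Q t z → e z = t z 0 ^ 2 / pairWronskian t z :=
    fun ht => (hs _).sq_div_pairWronskian_eq ht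
  have hW : ∀ {t z}, IsHomogeneousLift Q t z → pairWronskian t z ≠ 0 := fun {t z} ht => by
    obtain ⟨U, hU, hUi⟩ := hinj z
    exact ht.pairWronskian_ne_zero hU hUi
  have hed : Differentiable ℂ e := by
    intro z
    have h1 : e =ᶠ[𝓝 z] fun y => s z y 0 ^ 2 / pairWronskian (s z) y := by
      filter_upwards [(hs z).eventually] with y hy using heq hy
    refine (DifferentiableAt.div ?_ (hs z).analyticAt_pairWronskian.differentiableAt
      (hW (hs z))).congr_of_eventuallyEq h1
    exact (((hs z).analyticAt_apply 0).pow 2).differentiableAt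
  have hper : ∀ l, r l = 0 → ∀ z, e (z + l) = e z := by
    intro l hl z
    have h1 := (hs z).comp_sub (l := l) (fun y => by simp [hQ, hl])
    have h2 : ∀ i, deriv (fun y => s z (y - l) i) (z + l) = deriv (fun y => s z y i) z := by
      intro i
      rw [deriv_comp_sub_const (f := fun y => s z y i), add_sub_cancel_right]
    rw [heq h1, heq (hs z), pairWronskian, pairWronskian, h2, h2, add_sub_cancel_right]
  obtain ⟨R, hR⟩ := hr.exists_norm_sub_le
  obtain ⟨M, hM⟩ := (isCompact_closedBall (0 : ℂ) R).exists_bound_of_continuousOn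
    hed.continuous.continuousOn
  have hconst := hed.apply_eq_apply_of_bounded (isBounded_iff_forall_norm_le.mpr ⟨M, by
    rintro _ ⟨z, rfl⟩
    obtain ⟨l, hl, hzl⟩ := hR z
    have h1 := hper l hl (z - l)
    rw [sub_add_cancel] at h1
    rw [h1]
    exact hM _ (by simpa using hzl)⟩)
  have hpt : ∀ v : Fin 2 → ℂ, ∀ hv : v ≠ 0, ∃ (z c : ℂ), c ≠ 0 ∧ s z z = c • v := by
    intro v hv
    obtain ⟨x, hx⟩ := hqs (Projectivization.mk ℂ v hv)
    obtain ⟨z, rfl⟩ := hr.surjective x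
    obtain ⟨hz, hQz⟩ := (hs z).2.self_of_nhds
    obtain ⟨c, hc⟩ := (Projectivization.mk_eq_mk_iff' ℂ _ _ hz hv).mp (hQz.symm.trans hx)
    refine ⟨z, c, ?_, hc.symm⟩
    rintro rfl
    exact hz (by rw [← hc, zero_smul])
  -- `e` vanishes over the point `∞`, but not over the point `0`
  obtain ⟨z₀, c₀, -, h₀⟩ := hpt ![0, 1] (by simp)
  obtain ⟨z₁, c₁, hc₁, h₁⟩ := hpt ![1, 0] (by simp)
  have he₀ : e z₀ = 0 := by simp [he, h₀]
  have he₁ : e z₁ ≠ 0 := by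
    refine div_ne_zero (pow_ne_zero 2 ?_) (hW (hs z₁))
    simpa [h₁] using hc₁
  exact he₁ ((hconst z₁ z₀).trans he₀)

/-- Since `F / G` is the projective line, `G` does not act on `F` by translations alone. -/
theorem BagneraDeFranchis.exists_isDeck_ne_one {E F S : Type*}
    [TopologicalSpace E] [ChartedSpace ℂ E] [AddCommGroup E]
    [TopologicalSpace F] [ChartedSpace ℂ F] [AddCommGroup F] [T2Space F]
    [TopologicalSpace S] [ChartedSpace (ℂ × ℂ) S] (R : BagneraDeFranchis E F S)
    {p : ℂ →+ E} {r : ℂ →+ F} (hp : IsUniformization p) (hr : IsUniformization r) :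
    ∃ g a ζ b, R.IsDeck p r g a ζ b ∧ ζ ≠ 1 := by
  by_contra! hcon
  choose ζ b hζ hb using R.exists_isDeck_ρ hr
  have hζ1 : ∀ g, ζ g = 1 := by
    intro g
    obtain ⟨a, ha⟩ := hp.surjective (Multiplicative.toAdd g : R.G)
    exact hcon g a (ζ g) (b g) ⟨hζ g, ha, hb g⟩
  have := R.finite_G
  obtain ⟨q, hq, hqs, hqG⟩ := R.quotient_F
  refine hr.false_of_translation_fibers (Set.finite_range fun g => r (b g)) hq hqs fun x y hxy => ?_
  obtain ⟨g, rfl⟩ := (hqG x y).mp hxy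
  obtain ⟨w, rfl⟩ := hr.surjective x
  exact ⟨_, ⟨g, rfl⟩, by rw [← hb g w, hζ1, one_mul, map_add]⟩

/-! ### Lifts to the universal coverings -/

theorem IsUniformization.exists_continuous_descent {E X : Type*} [TopologicalSpace E]
    [ChartedSpace ℂ E] [AddCommGroup E] [TopologicalSpace X] {p : ℂ →+ E} (hp : IsUniformization p)
    {k : ℂ → X} (hk : Continuous k) (hkl : ∀ l, p l = 0 → ∀ z, k (z + l) = k z) :
    ∃ K : E → X, Continuous K ∧ ∀ z, K (p z) = k z := by
  have h1 : ∀ z, k (Function.surjInv hp.surjective (p z)) = k z := by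
    intro z
    have h2 : p (Function.surjInv hp.surjective (p z) - z) = 0 := by
      rw [map_sub, Function.surjInv_eq hp.surjective, sub_self]
    simpa using hkl _ h2 z
  refine ⟨fun x => k (Function.surjInv hp.surjective x), ?_, h1⟩
  rw [hp.isQuotientMap.continuous_iff]
  exact hk.congr fun z => (h1 z).symm

namespace BagneraDeFranchis

section

variable {E F S : Type*}
  [TopologicalSpace E] [ChartedSpace ℂ E] [AddCommGroup E]
  [TopologicalSpace F] [ChartedSpace ℂ F] [AddCommGroup F]
  [TopologicalSpace S] [ChartedSpace (ℂ × ℂ) S]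
  {p : ℂ →+ E} {r : ℂ →+ F} (hp : IsUniformization p) (hr : IsUniformization r)
  (R : BagneraDeFranchis E F S)

include hp hr

/-- Two lifts of the same map to the universal covering differ by a deck transformation. -/
theorem exists_isDeck_of_lifts [T2Space E] [T2Space F] {A : Type*} [TopologicalSpace A]
    [PreconnectedSpace A] [Nonempty A] {f k : A → ℂ × ℂ} (hf : Continuous f) (hk : Continuous k)
    (h : ∀ x, R.cover p r (f x) = R.cover p r (k x)) :
    ∃ g a ζ b, R.IsDeck p r g a ζ b ∧ ∀ x, f x = ((k x).1 + a, ζ * (k x).2 + b) := by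
  obtain ⟨x₀⟩ : Nonempty A := inferInstance
  obtain ⟨g, a, ζ, b, hd, hx⟩ := R.exists_isDeck_of_cover_eq hr (h x₀).symm
  refine ⟨g, a, ζ, b, hd, fun x => ?_⟩
  refine congrFun (R.eq_of_cover_lifts hp hr (g := fun x => ((k x).1 + a, ζ * (k x).2 + b))
    hf (by fun_prop) (fun x => ?_) x₀ hx) x
  rw [hd.cover_eq, h]

theorem contMDiff_cover :
    ContMDiff 𝓘(ℂ, ℂ × ℂ) 𝓘(ℂ, ℂ × ℂ) ω (R.cover p r) := by
  have h1 : ContMDiff 𝓘(ℂ, ℂ × ℂ) 𝓘(ℂ) ω (fun x : ℂ × ℂ => p x.1) :=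
    hp.isLocalDiffeomorph.contMDiff.comp contDiff_fst.contMDiff
  have h2 : ContMDiff 𝓘(ℂ, ℂ × ℂ) 𝓘(ℂ) ω (fun x : ℂ × ℂ => r x.2) :=
    hr.isLocalDiffeomorph.contMDiff.comp contDiff_snd.contMDiff
  exact R.localBiholomorphic_π.contMDiff.comp (h1.prodMk h2)

/-- The universal covering is locally biholomorphic; only a holomorphic local left inverse is
recorded. -/
theorem exists_local_inverse_cover (u : ℂ × ℂ) :
    ∃ k : S → ℂ × ℂ, ContMDiffAt 𝓘(ℂ, ℂ × ℂ) 𝓘(ℂ, ℂ × ℂ) ω k (R.cover p r u) ∧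
      ∀ᶠ v in 𝓝 u, k (R.cover p r v) = v := by
  obtain ⟨k, hk, hkl⟩ := (R.localBiholomorphic_π (p u.1, r u.2)).exists_leftInverse
  obtain ⟨j₁, hj₁, h₁⟩ := (hp.isLocalDiffeomorph u.1).exists_leftInverse
  obtain ⟨j₂, hj₂, h₂⟩ := (hr.isLocalDiffeomorph u.2).exists_leftInverse
  have hku : k (R.cover p r u) = (p u.1, r u.2) := hkl.self_of_nhds
  have hpr : ContinuousAt (fun v : ℂ × ℂ => (p v.1, r v.2)) u := by
    have := hp.continuous
    have := hr.continuous
    fun_prop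
  refine ⟨fun s => (j₁ (k s).1, j₂ (k s).2), ContMDiffAt.prodMk_space ?_ ?_, ?_⟩
  · refine ContMDiffAt.comp (R.cover p r u) (g := j₁) (f := fun s => (k s).1) ?_
      (contMDiffAt_fst.comp _ hk)
    rw [hku]
    exact hj₁
  · refine ContMDiffAt.comp (R.cover p r u) (g := j₂) (f := fun s => (k s).2) ?_
      (contMDiffAt_snd.comp _ hk)
    rw [hku]
    exact hj₂
  · filter_upwards [hpr.eventually hkl, continuous_fst.continuousAt.eventually h₁,
      continuous_snd.continuousAt.eventually h₂] with v hv h3 h4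
    change (j₁ (k (R.π (p v.1, r v.2))).1, j₂ (k (R.π (p v.1, r v.2))).2) = v
    rw [hv, h3, h4]

/-- The continuous lifts of an antiholomorphic map to the universal covering are antiholomorphic. -/
theorem differentiable_star_lift [IsManifold 𝓘(ℂ, ℂ × ℂ) ω S] {σ : S → S}
    (hσ : IsAntiholomorphic σ) {f : ℂ × ℂ → ℂ × ℂ} (hf : Continuous f)
    (h : ∀ x, R.cover p r (f x) = σ (R.cover p r x)) :
    Differentiable ℂ fun x => star (f x) := by
  intro x
  obtain ⟨k, hk, hkl⟩ := R.exists_local_inverse_cover hp hr (f x)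
  set c := chartAt (ℂ × ℂ) (R.cover p r x)
  set c' := chartAt (ℂ × ℂ) (σ (R.cover p r x))
  have hA : DifferentiableAt ℂ (fun y => c (R.cover p r y)) x := by
    have h1 : ContMDiffAt 𝓘(ℂ, ℂ × ℂ) 𝓘(ℂ, ℂ × ℂ) ω c (R.cover p r x) :=
      contMDiffAt_of_mem_maximalAtlas (IsManifold.chart_mem_maximalAtlas _)
        (mem_chart_source _ _)
    have h2 : ContMDiffAt 𝓘(ℂ, ℂ × ℂ) 𝓘(ℂ, ℂ × ℂ) ω (c ∘ R.cover p r) x :=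
      h1.comp x (R.contMDiff_cover hp hr x)
    exact h2.contDiffAt.differentiableAt (by simp)
  have hB : DifferentiableAt ℂ (fun y => k (c'.symm y)) (c' (σ (R.cover p r x))) := by
    have h1 : ContMDiffAt 𝓘(ℂ, ℂ × ℂ) 𝓘(ℂ, ℂ × ℂ) ω c'.symm (c' (σ (R.cover p r x))) :=
      contMDiffAt_symm_of_mem_maximalAtlas (IsManifold.chart_mem_maximalAtlas _)
        (mem_chart_target _ _)
    have h2 : ContMDiffAt 𝓘(ℂ, ℂ × ℂ) 𝓘(ℂ, ℂ × ℂ) ω (k ∘ c'.symm) (c' (σ (R.cover p r x))) := by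
      refine ContMDiffAt.comp _ ?_ h1
      rw [c'.left_inv (mem_chart_source _ _), ← h]
      exact hk
    exact h2.contDiffAt.differentiableAt (by simp)
  have hM := hσ.2 (R.cover p r x)
  have hB' : DifferentiableAt ℂ (fun y => star (k (c'.symm (star y))))
      (star (c' (σ (R.cover p r x)))) := hB.star_star
  have hMA : DifferentiableAt ℂ (fun y => star (c' (σ (c.symm (c (R.cover p r y)))))) x :=
    DifferentiableAt.comp x
      (g := fun z => star (c' (σ (c.symm z)))) (f := fun y => c (R.cover p r y)) hM hA
  have hcx : c.symm (c (R.cover p r x)) = R.cover p r x := c.left_inv (mem_chart_source _ _)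
  -- near `x`, the conjugate of `f` is the conjugate of the local inverse `k`, read in conjugate
  -- coordinates, after the holomorphic function through which `σ` is read in charts
  have hall : DifferentiableAt ℂ
      (fun y => star (k (c'.symm (star (star (c' (σ (c.symm (c (R.cover p r y))))))))) ) x := by
    refine DifferentiableAt.comp x (g := fun y => star (k (c'.symm (star y))))
      (f := fun y => star (c' (σ (c.symm (c (R.cover p r y)))))) ?_ hMA
    rw [hcx]
    exact hB'
  refine hall.congr_of_eventuallyEq ?_
  have hcov := R.continuous_cover hp hr
  filter_upwards [hcov.continuousAt.eventually
      (c.open_source.mem_nhds (mem_chart_source _ (R.cover p r x))),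
    (hσ.1.comp hcov).continuousAt.eventually
      (c'.open_source.mem_nhds (mem_chart_source _ (σ (R.cover p r x)))),
    hf.continuousAt.eventually hkl] with y h1 h2 h3
  have h4 : c'.symm (c' (σ (R.cover p r y))) = σ (R.cover p r y) := c'.left_inv h2
  rw [star_star, c.left_inv h1, h4, ← h, h3]

end

variable {E F S E' F' S' : Type*}
  [TopologicalSpace E] [ChartedSpace ℂ E] [AddCommGroup E]
  [TopologicalSpace F] [ChartedSpace ℂ F] [AddCommGroup F]
  [TopologicalSpace S] [ChartedSpace (ℂ × ℂ) S]
  [TopologicalSpace E'] [ChartedSpace ℂ E'] [AddCommGroup E']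
  [TopologicalSpace F'] [ChartedSpace ℂ F'] [AddCommGroup F']
  [TopologicalSpace S'] [ChartedSpace (ℂ × ℂ) S']
  {p : ℂ →+ E} {r : ℂ →+ F} (hp : IsUniformization p) (hr : IsUniformization r)
  {p' : ℂ →+ E'} {r' : ℂ →+ F'} (hp' : IsUniformization p') (hr' : IsUniformization r')
  (R : BagneraDeFranchis E F S) (R' : BagneraDeFranchis E' F' S')

include hp hr hp' hr'

/-- The continuous lifts of a holomorphic map to the universal coverings are holomorphic. -/
theorem differentiable_lift {ψ : S → S'} (hψ : ContMDiff 𝓘(ℂ, ℂ × ℂ) 𝓘(ℂ, ℂ × ℂ) ω ψ)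
    {f : ℂ × ℂ → ℂ × ℂ} (hf : Continuous f) (h : ∀ x, R'.cover p' r' (f x) = ψ (R.cover p r x)) :
    Differentiable ℂ f := by
  intro x
  obtain ⟨k, hk, hkl⟩ := R'.exists_local_inverse_cover hp' hr' (f x)
  rw [h] at hk
  have h1 : ContMDiffAt 𝓘(ℂ, ℂ × ℂ) 𝓘(ℂ, ℂ × ℂ) ω (k ∘ (ψ ∘ R.cover p r)) x :=
    hk.comp x ((hψ.comp (R.contMDiff_cover hp hr)) x)
  refine (h1.contDiffAt.differentiableAt (by simp)).congr_of_eventuallyEq ?_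
  filter_upwards [hf.continuousAt.eventually hkl] with y hy
  rw [h] at hy
  exact hy.symm

/-- A lift to the universal coverings has bounded increments at bounded distance: it carries the
translations by periods to deck transformations, which are isometries. -/
theorem exists_norm_lift_sub_le [T2Space E'] [T2Space F'] {ψ : S → S'} {f : ℂ × ℂ → ℂ × ℂ}
    (hf : Continuous f) (h : ∀ x, R'.cover p' r' (f x) = ψ (R.cover p r x)) :
    ∃ C, ∀ x y, ‖x - y‖ ≤ 1 → ‖f x - f y‖ ≤ C := by
  obtain ⟨R₁, hR₁⟩ := hp.exists_norm_sub_le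
  obtain ⟨R₂, hR₂⟩ := hr.exists_norm_sub_le
  refine exists_norm_sub_le_of_translations hf (R := max R₁ R₂) fun x => ?_
  obtain ⟨l₁, hl₁, h₁⟩ := hR₁ x.1
  obtain ⟨l₂, hl₂, h₂⟩ := hR₂ x.2
  refine ⟨(l₁, l₂), max_le_max h₁ h₂, fun u v => ?_⟩
  obtain ⟨g, a, ζ, b, hd, hx⟩ := R'.exists_isDeck_of_lifts hp' hr'
    (f := fun y => f (y + (l₁, l₂))) (k := f) (by fun_prop) hf (fun y => by
      rw [h, h]
      simp [cover, hl₁, hl₂])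
  rw [hx, hx, Prod.mk_sub_mk, add_sub_add_right_eq_sub, add_sub_add_right_eq_sub, ← mul_sub,
    Prod.norm_mk, norm_mul, hd.norm_eq_one, one_mul]
  rfl

/-- The lifts to the universal coverings of a holomorphic or antiholomorphic map are affine over
the real numbers. -/
theorem lift_eq_linearMap_add [T2Space E'] [T2Space F'] {ψ : S → S'} {f : ℂ × ℂ → ℂ × ℂ}
    (hf : Continuous f) (h : ∀ x, R'.cover p' r' (f x) = ψ (R.cover p r x))
    (hfd : Differentiable ℂ f ∨ Differentiable ℂ fun x => star (f x)) :
    ∃ L : ℂ × ℂ →ₗ[ℝ] ℂ × ℂ, ∀ x, f x = L x + f 0 := by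
  obtain ⟨C, hC⟩ := R.exists_norm_lift_sub_le hp hr hp' hr' R' hf h
  rcases hfd with hfd | hfd
  · obtain ⟨L, hL⟩ := exists_eq_continuousLinearMap_add_of_norm_sub_le hfd hC
    exact ⟨L.toLinearMap.restrictScalars ℝ, hL⟩
  · obtain ⟨L, hL⟩ := exists_eq_continuousLinearMap_add_of_norm_sub_le hfd (C := C)
      (fun x y hxy => by
        have h1 : ‖star (f x - f y)‖ = ‖f x - f y‖ := norm_star _
        rw [← star_sub, h1]
        exact hC x y hxy)
    refine ⟨{ toFun := fun x => star (L x)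
              map_add' := fun x y => by rw [map_add, star_add]
              map_smul' := fun c x => ?_ }, fun x => ?_⟩
    · have h1 : L (c • x) = c • L x := (L.restrictScalars ℝ).map_smul c x
      rw [h1]
      simp
    · have h1 := congrArg star (hL x)
      rw [star_star, star_add, star_star] at h1
      exact h1

/-- A homeomorphism whose lifts to the universal coverings are affine over the real numbers is
induced by a product of maps of the elliptic curves.  The linear part intertwines the linear parts
`(z, w) ↦ (z, ζ w)` of the deck transformations, and some `ζ` is not `1`, so it is diagonal; and the
periods of each factor are the deck transformations which are trivial on the other factor. -/
theorem exists_product_lift [LieAddGroup 𝓘(ℂ) ω E] [LieAddGroup 𝓘(ℂ) ω E']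
    [T2Space E] [T2Space F] [T2Space E'] [T2Space F']
    {ψ : S → S'} {χ : S' → S} (hψ : Continuous ψ) (hχ : Continuous χ)
    (hχψ : Function.LeftInverse χ ψ)
    (haff : ∀ f : ℂ × ℂ → ℂ × ℂ, Continuous f →
      (∀ x, R'.cover p' r' (f x) = ψ (R.cover p r x)) →
      ∃ L : ℂ × ℂ →ₗ[ℝ] ℂ × ℂ, ∀ x, f x = L x + f 0) :
    ∃ (Ψ₁ : E → E') (Ψ₂ : F → F'), Continuous Ψ₁ ∧ Continuous Ψ₂ ∧
      ∀ x, R'.π (Prod.map Ψ₁ Ψ₂ x) = ψ (R.π x) := by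
  obtain ⟨f, hf, hfψ⟩ := R'.exists_cover_lift hp' hr' (hψ.comp (R.continuous_cover hp hr))
  obtain ⟨k, hk, hkχ⟩ := R.exists_cover_lift hp hr (hχ.comp (R'.continuous_cover hp' hr'))
  obtain ⟨L, hL⟩ := haff f hf hfψ
  -- `k ∘ f` is a lift of the identity, hence a deck transformation
  have hfinj : Function.Injective f := by
    obtain ⟨g, a, ζ, b, hd, hx⟩ := R.exists_isDeck_of_lifts hp hr (f := fun x => k (f x))
      (k := fun x => x) (by fun_prop) (by fun_prop) (fun x => by
        rw [hkχ, Function.comp_apply, hfψ, Function.comp_apply, hχψ])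
    have hζ : ζ ≠ 0 := by
      rw [← norm_ne_zero_iff, hd.norm_eq_one]
      exact one_ne_zero
    intro x y hxy
    have h1 := congrArg k hxy
    rw [hx, hx, Prod.mk.injEq] at h1
    exact Prod.ext (add_right_cancel h1.1) (mul_left_cancel₀ hζ (add_right_cancel h1.2))
  have hLinj : Function.Injective L := fun x y hxy => hfinj (by rw [hL x, hL y, hxy])
  have hequiv : ∀ {g a ζ b}, R.IsDeck p r g a ζ b → ∃ g' a' ζ' b', R'.IsDeck p' r' g' a' ζ' b' ∧
      ∀ x : ℂ × ℂ, f (x.1 + a, ζ * x.2 + b) = ((f x).1 + a', ζ' * (f x).2 + b') := fun hd =>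
    R'.exists_isDeck_of_lifts hp' hr' (by fun_prop) hf
      (fun x => by rw [hfψ, hfψ, Function.comp_apply, Function.comp_apply, hd.cover_eq])
  -- the linear part is diagonal
  obtain ⟨g₀, a₀, ζ, b₀, hd₀, hζ⟩ := R.exists_isDeck_ne_one hp hr
  obtain ⟨g₀', a₀', ζ', b₀', hd₀', hx₀⟩ := hequiv hd₀
  have hcomm : ∀ z w, L (z, ζ * w) = ((L (z, w)).1, ζ' * (L (z, w)).2) := by
    intro z w
    have h1 := hx₀ (z, w)
    have h2 := hx₀ 0
    rw [hL, hL (z, w)] at h1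
    rw [hL] at h2
    have h3 : L (z + a₀, ζ * w + b₀) = L (z, ζ * w) + L (a₀, b₀) := by
      rw [← map_add, Prod.mk_add_mk]
    simp only [h3, Prod.fst_zero, Prod.snd_zero, zero_add, mul_zero] at h1 h2
    have h4 := congrArg Prod.fst h1
    have h5 := congrArg Prod.snd h1
    have h6 := congrArg Prod.fst h2
    have h7 := congrArg Prod.snd h2
    simp only [Prod.fst_add, Prod.snd_add] at h4 h5 h6 h7
    refine Prod.ext ?_ ?_
    · simp only
      linear_combination h4 - h6
    · simp only
      linear_combination h5 - h7
  have hζ' : ζ' ≠ 1 := by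
    rintro rfl
    have h1 := hcomm 0 1
    rw [one_mul, Prod.mk.eta] at h1
    exact hζ (by simpa using congrArg Prod.snd (hLinj h1))
  have hL₂ : ∀ z, (L (z, 0)).2 = 0 := by
    intro z
    have h1 := congrArg Prod.snd (hcomm z 0)
    simp only [mul_zero] at h1
    have h2 : (ζ' - 1) * (L (z, 0)).2 = 0 := by linear_combination -h1
    exact (mul_eq_zero.mp h2).resolve_left (sub_ne_zero.mpr hζ')
  have hL₁ : ∀ w, (L (0, w)).1 = 0 := by
    intro w
    have h1 := congrArg Prod.fst (hcomm 0 (w / (ζ - 1)))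
    have h2 : ((0, ζ * (w / (ζ - 1))) : ℂ × ℂ) = (0, w / (ζ - 1)) + (0, w) := by
      have := sub_ne_zero.mpr hζ
      ext
      · simp
      · simp only [Prod.mk_add_mk]
        field_simp
        ring
    rw [h2, map_add, Prod.fst_add] at h1
    simpa using h1
  have hLsplit : ∀ z w, L (z, w) = ((L (z, 0)).1, (L (0, w)).2) := by
    intro z w
    have h1 : ((z, w) : ℂ × ℂ) = (z, 0) + (0, w) := by simp
    rw [h1, map_add]
    ext <;> simp [hL₁, hL₂]
  have hf₁ : ∀ z w, (f (z, w)).1 = (f (z, 0)).1 := fun z w => by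
    rw [hL, hL (z, 0), hLsplit z w, hLsplit z 0]
    rfl
  have hf₂ : ∀ z w, (f (z, w)).2 = (f (0, w)).2 := fun z w => by
    rw [hL, hL (0, w), hLsplit z w, hLsplit 0 w]
    rfl
  have hL01 : (L (0, 1)).2 ≠ 0 := by
    intro h1
    have h2 : L (0, 1) = L 0 := by
      rw [map_zero]
      exact Prod.ext (hL₁ 1) h1
    simpa using congrArg Prod.snd (hLinj h2)
  -- a period `l` of `E` goes to a translation along the first factor, hence to a deck
  -- transformation which is trivial on the second factor
  obtain ⟨Ψ₁, hΨ₁, h₁⟩ := hp.exists_continuous_descent (k := fun z => p' (f (z, 0)).1)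
    (hp'.continuous.comp (by fun_prop)) (fun l hl z => by
      obtain ⟨g', a', ζ', b', hd', hx⟩ := hequiv (R.isDeck_fst hl)
      have h2 := congrArg Prod.snd (hx (0, 0))
      have h3 := congrArg Prod.snd (hx (0, 1))
      simp only [hf₂ _ _, mul_zero, zero_add, add_zero, mul_one] at h2 h3
      have h4 : (f (0, 1)).2 - (f (0, 0)).2 = (L (0, 1)).2 := by
        rw [hL (0, 1)]
        exact add_sub_cancel_right _ _
      have h5 : (ζ' - 1) * (L (0, 1)).2 = 0 := by
        rw [← h4]
        linear_combination h2 - h3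
      obtain rfl : ζ' = 1 := sub_eq_zero.mp ((mul_eq_zero.mp h5).resolve_right hL01)
      obtain rfl : b' = 0 := by linear_combination -h2
      have hg := hd'.eq_one_of_snd hr' (by simp)
      have h6 := congrArg Prod.fst (hx (z, 0))
      simp only [mul_zero, add_zero] at h6
      rw [h6, map_add, hd'.apply_fst, hg]
      simp)
  -- likewise with the two factors exchanged
  obtain ⟨Ψ₂, hΨ₂, h₂⟩ := hr.exists_continuous_descent (k := fun w => r' (f (0, w)).2)
    (hr'.continuous.comp (by fun_prop)) (fun l hl w => by
      obtain ⟨g', a', ζ', b', hd', hx⟩ := hequiv (R.isDeck_snd hl)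
      have h3 := hx (0, w)
      simp only [add_zero, one_mul] at h3
      have h4 := congrArg Prod.fst h3
      simp only [hf₁ _ _] at h4
      have hg := hd'.eq_one_of_fst (by rw [left_eq_add.mp h4, map_zero])
      rw [h3, hd'.apply_snd, hg, map_one]
      rfl)
  refine ⟨Ψ₁, Ψ₂, hΨ₁, hΨ₂, ?_⟩
  rintro ⟨x, y⟩
  obtain ⟨z, rfl⟩ := hp.surjective x
  obtain ⟨w, rfl⟩ := hr.surjective y
  rw [Prod.map_apply, h₁, h₂, ← hf₁ z w, ← hf₂ z w]
  exact hfψ (z, w)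

end BagneraDeFranchis

/-! ### Lifts to the product of the elliptic curves -/

namespace BagneraDeFranchis

variable {E F S E' F' S' : Type*}
  [TopologicalSpace E] [ChartedSpace ℂ E] [AddCommGroup E]
  [TopologicalSpace F] [ChartedSpace ℂ F]
  [TopologicalSpace S] [ChartedSpace (ℂ × ℂ) S]
  [TopologicalSpace E'] [ChartedSpace ℂ E'] [AddCommGroup E']
  [TopologicalSpace F'] [ChartedSpace ℂ F']
  [TopologicalSpace S'] [ChartedSpace (ℂ × ℂ) S']

/-- If a product of continuous maps induces a holomorphic map of the surfaces, then both factors are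
holomorphic. -/
theorem contMDiff_factors_of_lift [Nonempty E] [Nonempty F]
    (R : BagneraDeFranchis E F S) (R' : BagneraDeFranchis E' F' S') {ψ : S → S'}
    (hψ : ContMDiff 𝓘(ℂ, ℂ × ℂ) 𝓘(ℂ, ℂ × ℂ) ω ψ) {Ψ₁ : E → E'} {Ψ₂ : F → F'}
    (h₁ : Continuous Ψ₁) (h₂ : Continuous Ψ₂) (h : ∀ x, R'.π (Prod.map Ψ₁ Ψ₂ x) = ψ (R.π x)) :
    ContMDiff 𝓘(ℂ) 𝓘(ℂ) ω Ψ₁ ∧ ContMDiff 𝓘(ℂ) 𝓘(ℂ) ω Ψ₂ := by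
  have h3 : ContMDiff (𝓘(ℂ).prod 𝓘(ℂ)) (𝓘(ℂ).prod 𝓘(ℂ)) ω (Prod.map Ψ₁ Ψ₂) := by
    refine R'.localBiholomorphic_π.contMDiff_of_comp (h₁.prodMap h₂) ?_
    rw [show R'.π ∘ Prod.map Ψ₁ Ψ₂ = ψ ∘ R.π from funext h]
    exact hψ.comp R.localBiholomorphic_π.contMDiff
  obtain ⟨x₀⟩ : Nonempty E := inferInstance
  obtain ⟨y₀⟩ : Nonempty F := inferInstance
  exact ⟨contMDiff_fst.comp (h3.comp (contMDiff_id.prodMk (contMDiff_const (c := y₀)))),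
    contMDiff_snd.comp (h3.comp ((contMDiff_const (c := x₀)).prodMk contMDiff_id))⟩

/-- Conjugation by a homeomorphism `Ψ` which induces `ψ : S → S'` identifies the lifts of `τ` with
the lifts of `ψ τ ψ⁻¹`. -/
theorem isLift_conj_iff (R : BagneraDeFranchis E F S) (R' : BagneraDeFranchis E' F' S')
    (ψ : S ≃ S') {τ : S → S} {τ' : S' → S'} (hψ : ∀ x, ψ (τ x) = τ' (ψ x))
    (Ψ : E × F ≃ₜ E' × F') (hΨ : ∀ x, R'.π (Ψ x) = ψ (R.π x)) (h : E × F ≃ₜ E × F) :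
    R.IsLift τ h ↔ R'.IsLift τ' ((Ψ.symm.trans h).trans Ψ) := by
  have h1 : R'.IsLift τ' ((Ψ.symm.trans h).trans Ψ) ↔ ∀ x, R'.π (Ψ (h x)) = τ' (R'.π (Ψ x)) :=
    ⟨fun H x => by simpa using H (Ψ x), fun H y => by simpa using H (Ψ.symm y)⟩
  rw [h1]
  refine forall_congr' fun x => ?_
  rw [hΨ, hΨ, ← hψ, ψ.apply_eq_iff_eq]

variable [LieAddGroup 𝓘(ℂ) ω E]

/-- Two lifts of the same map to `E × F` differ by an element of `G`. -/
theorem exists_action_eq_of_lifts [T2Space E] [T2Space F] (R : BagneraDeFranchis E F S) {A : Type*}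
    [TopologicalSpace A] [PreconnectedSpace A] [Nonempty A] {f k : A → E × F} (hf : Continuous f)
    (hk : Continuous k) (h : ∀ x, R.π (f x) = R.π (k x)) : ∃ g, ∀ x, f x = R.action g (k x) := by
  obtain ⟨x₀⟩ : Nonempty A := inferInstance
  obtain ⟨g, hg⟩ := R.exists_action_eq (h x₀).symm
  exact ⟨g, congrFun (R.eq_of_lifts hf ((R.action g).continuous.comp hk)
    (fun x => by rw [h]; exact (R.π_action g _).symm) x₀ hg)⟩

theorem mem_symmetryGroup_iff [T2Space E] [T2Space F] [PreconnectedSpace (E × F)]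
    [Nonempty (E × F)] (R : BagneraDeFranchis E F S) (h : E × F ≃ₜ E × F) :
    h ∈ R.symmetryGroup ↔ R.IsLift id h := by
  constructor
  · rintro ⟨g, rfl⟩ x
    exact R.π_action g x
  · intro hh
    obtain ⟨g, hg⟩ := R.exists_action_eq_of_lifts h.continuous continuous_id hh
    exact ⟨g, Homeomorph.ext fun x => (hg x).symm⟩

/-- Continuous lifts of two mutually inverse maps are inverse to each other, up to an element of
`G`. -/
theorem exists_inverse_of_lifts [T2Space E] [T2Space F] [T2Space E'] [T2Space F']
    [PreconnectedSpace (E × F)] [Nonempty (E × F)] [PreconnectedSpace (E' × F')]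
    (R : BagneraDeFranchis E F S) (R' : BagneraDeFranchis E' F' S') {ψ : S → S'} {χ : S' → S}
    (hχψ : Function.LeftInverse χ ψ) (hψχ : Function.RightInverse χ ψ)
    {H : E × F → E' × F'} {K : E' × F' → E × F} (hH : Continuous H) (hK : Continuous K)
    (hHψ : ∀ x, R'.π (H x) = ψ (R.π x)) (hKχ : ∀ x, R.π (K x) = χ (R'.π x)) :
    ∃ g, (∀ x, R.action g (K (H x)) = x) ∧ ∀ y, H (R.action g (K y)) = y := by
  obtain ⟨g, hg⟩ := R.exists_action_eq_of_lifts (f := fun x => x) (k := fun x => K (H x))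
    (by fun_prop) (by fun_prop) (fun x => by rw [hKχ, hHψ, hχψ])
  refine ⟨g, fun x => (hg x).symm, ?_⟩
  obtain ⟨x₀⟩ : Nonempty (E × F) := inferInstance
  have hgc := (R.action g).continuous
  refine congrFun (R'.eq_of_lifts (f := fun y => H (R.action g (K y))) (g := fun y => y)
    (by fun_prop) (by fun_prop) (fun y => ?_) (H x₀) ?_)
  · rw [hHψ, R.π_action, hKχ, hψχ]
  · rw [← hg]

theorem exists_homeomorph_isLift [T2Space E] [T2Space F] [PreconnectedSpace (E × F)]
    [Nonempty (E × F)] (R : BagneraDeFranchis E F S) {σ : S → S} (hσ : Function.Involutive σ)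
    {H : E × F → E × F} (hH : Continuous H) (h : ∀ x, R.π (H x) = σ (R.π x)) :
    ∃ h, R.IsLift σ h := by
  obtain ⟨g, h1, h2⟩ := R.exists_inverse_of_lifts R hσ hσ hH hH h h
  exact ⟨{ toFun := H
           invFun := fun x => R.action g (H x)
           left_inv := h1
           right_inv := h2
           continuous_toFun := hH
           continuous_invFun := (R.action g).continuous.comp hH }, h⟩

end BagneraDeFranchis

/-- Conjugation by a homeomorphism, as an isomorphism of homeomorphism groups. -/
def Homeomorph.conjMulEquiv {X Y : Type*} [TopologicalSpace X] [TopologicalSpace Y] (Ψ : X ≃ₜ Y) :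
    (X ≃ₜ X) ≃* (Y ≃ₜ Y) where
  toFun h := (Ψ.symm.trans h).trans Ψ
  invFun h := (Ψ.trans h).trans Ψ.symm
  left_inv h := by ext; simp
  right_inv h := by ext; simp
  map_mul' h k := by ext; simp

/-! ### Real hyperelliptic surfaces -/

theorem mainTheorem6
    {E F S E' F' S' : Type*}
    [TopologicalSpace E] [ChartedSpace ℂ E] [AddCommGroup E] [LieAddGroup 𝓘(ℂ) ω E]
    [TopologicalSpace F] [ChartedSpace ℂ F] [AddCommGroup F] [LieAddGroup 𝓘(ℂ) ω F]
    [TopologicalSpace S] [ChartedSpace (ℂ × ℂ) S] [IsManifold 𝓘(ℂ, ℂ × ℂ) ω S]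
    [TopologicalSpace E'] [ChartedSpace ℂ E'] [AddCommGroup E'] [LieAddGroup 𝓘(ℂ) ω E']
    [TopologicalSpace F'] [ChartedSpace ℂ F'] [AddCommGroup F'] [LieAddGroup 𝓘(ℂ) ω F']
    [TopologicalSpace S'] [ChartedSpace (ℂ × ℂ) S'] [IsManifold 𝓘(ℂ, ℂ × ℂ) ω S']
    (hE : IsEllipticCurve E) (hF : IsEllipticCurve F)
    (hE' : IsEllipticCurve E') (hF' : IsEllipticCurve F')
    (R : BagneraDeFranchis E F S) (R' : BagneraDeFranchis E' F' S')
    (σ : S → S) (hσ : IsRealStructure σ) (σ' : S' → S') (hσ' : IsRealStructure σ')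
    (ψ : Diffeomorph 𝓘(ℂ, ℂ × ℂ) 𝓘(ℂ, ℂ × ℂ) S S' ω) (hψ : ∀ x, ψ (σ x) = σ' (ψ x)) :
    (∃ h, R.IsLift σ h) ∧ (∃ h, R'.IsLift σ' h) ∧
    ∃ (φ : R.extendedSymmetryGroup σ ≃* R'.extendedSymmetryGroup σ')
      (Ψ₁ : Diffeomorph 𝓘(ℂ) 𝓘(ℂ) E E' ω) (Ψ₂ : Diffeomorph 𝓘(ℂ) 𝓘(ℂ) F F' ω),
      (∀ h : R.extendedSymmetryGroup σ, (h : E × F ≃ₜ E × F) ∈ R.symmetryGroup ↔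
        (φ h : E' × F' ≃ₜ E' × F') ∈ R'.symmetryGroup) ∧
      (∀ h : R.extendedSymmetryGroup σ, R.IsLift σ h ↔ R'.IsLift σ' (φ h)) ∧
      (∀ (h : R.extendedSymmetryGroup σ) (x : E × F), Prod.map Ψ₁ Ψ₂ ((h : E × F ≃ₜ E × F) x) =
        (φ h : E' × F' ≃ₜ E' × F') (Prod.map Ψ₁ Ψ₂ x)) ∧
      (∀ x : E × F, R'.π (Prod.map Ψ₁ Ψ₂ x) = ψ (R.π x)) := by
  obtain ⟨p, hp⟩ := hE.exists_isUniformization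
  obtain ⟨r, hr⟩ := hF.exists_isUniformization
  obtain ⟨p', hp'⟩ := hE'.exists_isUniformization
  obtain ⟨r', hr'⟩ := hF'.exists_isUniformization
  have := hp.t2Space
  have := hr.t2Space
  have := hp'.t2Space
  have := hr'.t2Space
  have := hp.connectedSpace
  have := hr.connectedSpace
  have := hp'.connectedSpace
  have := hr'.connectedSpace
  -- `σ` and `ψ` have lifts of product type, the former because its lifts to `ℂ × ℂ` are
  -- antiholomorphic
  have hlift : ∃ h, R.IsLift σ h := by
    obtain ⟨H₁, H₂, h₁, h₂, hH⟩ := R.exists_product_lift hp hr hp hr R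
      hσ.antiholomorphic.1 hσ.antiholomorphic.1 hσ.involutive fun f hf hfσ =>
        R.lift_eq_linearMap_add hp hr hp hr R hf hfσ
          (Or.inr (R.differentiable_star_lift hp hr hσ.antiholomorphic hf hfσ))
    exact R.exists_homeomorph_isLift hσ.involutive (h₁.prodMap h₂) hH
  have hhol := fun (f : ℂ × ℂ → ℂ × ℂ) hf (hfψ : ∀ x, R'.cover p' r' (f x) = ψ (R.cover p r x)) =>
    R.lift_eq_linearMap_add hp hr hp' hr' R' hf hfψ
      (Or.inl (R.differentiable_lift hp hr hp' hr' R' ψ.contMDiff hf hfψ))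
  have hhol' := fun (f : ℂ × ℂ → ℂ × ℂ) hf
      (hfψ : ∀ x, R.cover p r (f x) = ψ.symm (R'.cover p' r' x)) =>
    R'.lift_eq_linearMap_add hp' hr' hp hr R hf hfψ
      (Or.inl (R'.differentiable_lift hp' hr' hp hr R ψ.symm.contMDiff hf hfψ))
  obtain ⟨Ψ₁, Ψ₂, hΨ₁, hΨ₂, hΨ⟩ := R.exists_product_lift hp hr hp' hr' R' ψ.continuous
    ψ.symm.continuous ψ.symm_apply_apply hhol
  obtain ⟨Φ₁, Φ₂, hΦ₁, hΦ₂, hΦ⟩ := R'.exists_product_lift hp' hr' hp hr R ψ.symm.continuous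
    ψ.continuous ψ.apply_symm_apply hhol'
  obtain ⟨g, hg, hg'⟩ := R.exists_inverse_of_lifts R' ψ.symm_apply_apply ψ.apply_symm_apply
    (hΨ₁.prodMap hΨ₂) (hΦ₁.prodMap hΦ₂) hΨ hΦ
  have hΨs := R.contMDiff_factors_of_lift R' ψ.contMDiff hΨ₁ hΨ₂ hΨ
  have hΦs := R'.contMDiff_factors_of_lift R ψ.symm.contMDiff hΦ₁ hΦ₂ hΦ
  let Θ₁ : Diffeomorph 𝓘(ℂ) 𝓘(ℂ) E E' ω :=
    { toFun := Ψ₁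
      invFun := fun y => (Multiplicative.toAdd g : R.G) + Φ₁ y
      left_inv := fun x => by
        obtain ⟨y⟩ : Nonempty F := inferInstance
        exact congrArg Prod.fst (hg (x, y))
      right_inv := fun x => by
        obtain ⟨y⟩ : Nonempty F' := inferInstance
        exact congrArg Prod.fst (hg' (x, y))
      contMDiff_toFun := hΨs.1
      contMDiff_invFun := contMDiff_const.add hΦs.1 }
  let Θ₂ : Diffeomorph 𝓘(ℂ) 𝓘(ℂ) F F' ω :=
    { toFun := Ψ₂
      invFun := fun y => R.ρ g (Φ₂ y)
      left_inv := fun y => by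
        obtain ⟨x⟩ : Nonempty E := inferInstance
        exact congrArg Prod.snd (hg (x, y))
      right_inv := fun y => by
        obtain ⟨x⟩ : Nonempty E' := inferInstance
        exact congrArg Prod.snd (hg' (x, y))
      contMDiff_toFun := hΨs.2
      contMDiff_invFun := (R.holomorphic_ρ g).comp hΦs.2 }
  let Ψ : E × F ≃ₜ E' × F' := Θ₁.toHomeomorph.prodCongr Θ₂.toHomeomorph
  have hΨψ : ∀ x, R'.π (Ψ x) = ψ.toEquiv (R.π x) := hΨ
  have hconj := R.isLift_conj_iff R' ψ.toEquiv hψ Ψ hΨψ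
  have hconj' := R.isLift_conj_iff R' ψ.toEquiv (τ := id) (τ' := id) (fun _ => rfl) Ψ hΨψ
  -- `G` consists of the lifts of the identity, so conjugation by `Ψ` respects it as well
  have hsym : ∀ h, h ∈ R.symmetryGroup ↔ Ψ.conjMulEquiv h ∈ R'.symmetryGroup := fun h => by
    rw [R.mem_symmetryGroup_iff, R'.mem_symmetryGroup_iff]
    exact hconj' h
  have hmap : (R.extendedSymmetryGroup σ).map (Ψ.conjMulEquiv : _ →* _) =
      R'.extendedSymmetryGroup σ' := by
    rw [BagneraDeFranchis.extendedSymmetryGroup, BagneraDeFranchis.extendedSymmetryGroup,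
      MonoidHom.map_closure]
    congr 1
    ext h
    constructor
    · rintro ⟨k, hk | hk, rfl⟩
      · exact Or.inl ((hsym k).mp hk)
      · exact Or.inr ((hconj k).mp hk)
    · intro hh
      obtain ⟨k, rfl⟩ := Ψ.conjMulEquiv.surjective h
      exact ⟨k, hh.imp (hsym k).mpr (hconj k).mpr, rfl⟩
  obtain ⟨h₀, hh₀⟩ := hlift
  refine ⟨⟨h₀, hh₀⟩, ⟨_, (hconj h₀).mp hh₀⟩,
    (Ψ.conjMulEquiv.subgroupMap _).trans (MulEquiv.subgroupCongr hmap), Θ₁, Θ₂,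
    fun h => hsym h, fun h => hconj h, fun h x => ?_, hΨ⟩
  change Ψ (h.1 x) = Ψ (h.1 (Ψ.symm (Ψ x)))
  rw [Ψ.symm_apply_apply]
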